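/- For integers $k,\ell\ge 0$ let $$\Theta_{k,\ell}=\frac{2}{(k+1)^2(k+2)}\binom{k+\ell}{k}\binom{k+\ell+1}{k}\binom{k+\ell+2}{k},$$ and for $n\ge 1$ let $B_n=\sum_{k=0}^{n-1}\Theta_{k,\,n-1-k}$ be the Baxter number. A full binary tree is a rooted ordered tree in which each inner vertex has exactly two children, a left one and a right one. A left (right) leaf is a leaf that is a left (right) child. The fingerprint of a full binary tree is the $0,1$ string whose $i$th entry is $1$ if the $i$th leaf from the left is a left leaf and $0$ if it is a right leaf; the reduced fingerprint $\hat\alpha(T)$ is obtained by omitting its first and last entries. A pair $(A,B)$ of full binary trees is a twin pair of binary trees if $\hat\alpha(A)$ is the reverse of $\hat\alpha(B)$; it has $a$ left leaves and $b$ right leaves if each of $A$ and $B$ does. A permutation $\pi$ of $[n]$ is a Baxter permutation if there are no indices $i<j$, $j+1<m$ with $\pi_{j+1}<\pi_i<\pi_m<\pi_j$ or with $\pi_{j+1}>\pi_i>\pi_m>\pi_j$. A descent (rise) of $\pi$ is an adjacent pair $(\pi_{i},\pi_{i+1})$, $1\le i<n$, with $\pi_{i}>\pi_{i+1}$ (with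 $\pi_{i}<\pi_{i+1}$). Proposition. For all $k,\ell\ge 0$, the number $\Theta_{k,\ell}$ counts - the twin pairs of binary trees with $k+1$ left leaves and $\ell+1$ right leaves (in particular, there are finitely many of them), and - the Baxter permutations of $[k+\ell+1]$ with $k$ descents and $\ell$ rises. Consequently, for every $n\ge 1$, the number of Baxter permutations of $[n]$ is the Baxter number $B_n$. -/

import Mathlib

namespace Baxter

/-- The number `Θ_{k,ℓ} = 2 / ((k+1)² (k+2)) * C(k+ℓ, k) * C(k+ℓ+1, k) * C(k+ℓ+2, k)`,
as a rational number. -/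
def theta (k l : ℕ) : ℚ :=
  2 / (((k : ℚ) + 1) ^ 2 * ((k : ℚ) + 2)) *
    ((k + l).choose k : ℚ) * ((k + l + 1).choose k : ℚ) * ((k + l + 2).choose k : ℚ)

/-- The Baxter number `B_n = ∑_{k=0}^{n-1} Θ_{k,n-1-k}`, for `n ≥ 1`. -/
def baxterNumber (n : ℕ) : ℚ :=
  ∑ k ∈ Finset.range n, theta k (n - 1 - k)

/-! ### Full binary trees -/

/-- Full binary trees: rooted ordered trees in which each inner vertex has exactly two children,
a left one and a right one. Here `nil` is a leaf and `node () l r` is an inner vertex. -/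
abbrev FullBinaryTree : Type := BinaryTree Unit

/-- The fingerprint of a subtree hanging below some vertex, as its left child if `isLeft = true`
and as its right child if `isLeft = false`: the leaves are listed from left to right, with entry
`true` (that is, `1`) for a left child and `false` (that is, `0`) for a right child. -/
def childFingerprint (isLeft : Bool) : FullBinaryTree → List Bool
  | .nil => [isLeft]
  | .node _ l r => childFingerprint true l ++ childFingerprint false r

/-- The fingerprint of a full binary tree. If the tree is a single leaf, that leaf is neither
a left nor a right child, and the fingerprint is empty. -/
def fingerprint : FullBinaryTree → List Bool
  | .nil => []
  | .node _ l r => childFingerprint true l ++ childFingerprint false r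

/-- The number of leaves that are left children. -/
def leftLeaves (T : FullBinaryTree) : ℕ := (fingerprint T).count true

/-- The number of leaves that are right children. -/
def rightLeaves (T : FullBinaryTree) : ℕ := (fingerprint T).count false

/-- The reduced fingerprint: the first and the last entry are omitted. -/
def reducedFingerprint (T : FullBinaryTree) : List Bool :=
  (fingerprint T).tail.dropLast

/-- `(A, B)` is a twin pair of binary trees: the reduced fingerprint of `A` is the reverse of
the reduced fingerprint of `B`. -/
def IsTwinPair (A B : FullBinaryTree) : Prop :=
  reducedFingerprint A = (reducedFingerprint B).reverse

/-- The twin pairs of binary trees with `a` left leaves and `b` right leaves (each of the two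
trees has that many). -/
def twinPairs (a b : ℕ) : Set (FullBinaryTree × FullBinaryTree) :=
  {P | IsTwinPair P.1 P.2 ∧
    (leftLeaves P.1 = a ∧ rightLeaves P.1 = b) ∧
    (leftLeaves P.2 = a ∧ rightLeaves P.2 = b)}

/-! ### Baxter permutations -/

/-- A permutation is Baxter if it avoids the patterns `2-41-3` and `3-14-2`: there are no
positions `i < j`, `j + 1 < k` with `π (j+1) < π i < π k < π j` nor with
`π (j+1) > π i > π k > π j`. In the code, `j'` is the position `j + 1`. -/
def IsBaxter {n : ℕ} (π : Equiv.Perm (Fin n)) : Prop :=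
  ∀ i j j' k : Fin n, i < j → (j' : ℕ) = (j : ℕ) + 1 → j' < k →
    ¬ (π j' < π i ∧ π i < π k ∧ π k < π j) ∧
    ¬ (π j' > π i ∧ π i > π k ∧ π k > π j)

/-- The number of descents: adjacent positions `i, i + 1` with `π i > π (i+1)`. -/
noncomputable def descents {n : ℕ} (π : Equiv.Perm (Fin n)) : ℕ :=
  Set.ncard {i : Fin n | ∃ h : (i : ℕ) + 1 < n, π i > π ⟨(i : ℕ) + 1, h⟩}

/-- The number of rises: adjacent positions `i, i + 1` with `π i < π (i+1)`. -/
noncomputable def rises {n : ℕ} (π : Equiv.Perm (Fin n)) : ℕ :=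
  Set.ncard {i : Fin n | ∃ h : (i : ℕ) + 1 < n, π i < π ⟨(i : ℕ) + 1, h⟩}

end Baxter

/-! Twin pairs and Baxter permutations are both produced by one generating tree. A vertex labelled
`(d, i, j)` has the children `(d + 1, x, j + 1)` for `x ≤ i` and `(d, i + 1, y)` for `y ≤ j`, and
the root is `(0, 0, 0)`. Here `d` is the statistic that has to equal `k`, so `Θ` must count the
vertices with `d = k` on level `k + l`.

To count them, sum the weights `C(i, a) C(j, b)` over the vertices with `d = k` on a level. By the
hockey-stick and Pascal identities these weighted sums obey the recursion of quadrant walks with `k`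
marked steps (`childSum_binomialWeight`). That recursion is solved by a 3 × 3 determinant of
binomial coefficients, as for three non-intersecting lattice paths (`quadrantWalks_eq_tripleDet`).
At `a = b = 0` the determinant is `Θ` (`quadrantWalks_eq_theta`).

For trees (`twinSum_succ`), mirroring the second tree makes the reduced fingerprints complementary.
Prepending a letter to a fingerprint raises the length of the left branch by one or allows every
smaller value, and a letter and its complement act in opposite ways on the two trees.

For permutations (`baxterSum_succ`), the maximum of a Baxter permutation stands directly after a
right-to-left maximum or directly before a left-to-right maximum of the rest, and every such
insertion preserves the Baxter property. The labels `i` and `j` are the numbers of left-to-right and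
right-to-left maxima, less one. -/

namespace Baxter

/-! ### A walk recursion and its solution by determinants of binomial coefficients -/

/-- Binomial coefficients with an integer lower index, zero when it is negative. -/
def zchoose (n : ℕ) (z : ℤ) : ℤ := if 0 ≤ z then (n.choose z.toNat : ℤ) else 0

lemma zchoose_natCast (n m : ℕ) : zchoose n (m : ℤ) = n.choose m := by
  simp [zchoose]

lemma zchoose_of_neg (n : ℕ) {z : ℤ} (h : z < 0) : zchoose n z = 0 := by
  simp [zchoose, h]

lemma zchoose_succ (n : ℕ) (z : ℤ) :
    zchoose (n + 1) z = zchoose n z + zchoose n (z - 1) := by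
  rcases lt_trichotomy z 0 with h | h | h
  · rw [zchoose_of_neg _ h, zchoose_of_neg _ h, zchoose_of_neg _ (by omega), add_zero]
  · subst h
    simp [zchoose]
  · obtain ⟨m, rfl⟩ : ∃ m : ℕ, z = ((m + 1 : ℕ) : ℤ) := ⟨(z - 1).toNat, by omega⟩
    rw [show ((m + 1 : ℕ) : ℤ) - 1 = (m : ℕ) by push_cast; ring]
    simp only [zchoose_natCast]
    rw [Nat.choose_succ_succ]
    push_cast
    ring

lemma zchoose_zero (z : ℤ) : zchoose 0 z = if z = 0 then 1 else 0 := by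
  rcases lt_or_ge z 0 with h | h
  · rw [zchoose_of_neg _ h, if_neg h.ne]
  · lift z to ℕ using h
    rw [zchoose_natCast]
    cases z <;> simp
    omega

/-- The determinant whose columns are `(C(n, x), C(n, x - 1), C(n, x - 2))` for `x = p, q, r`. -/
def tripleDet (n : ℕ) (p q r : ℤ) : ℤ :=
  zchoose n p * (zchoose n (q - 1) * zchoose n (r - 2) - zchoose n (q - 2) * zchoose n (r - 1)) -
  zchoose n q * (zchoose n (p - 1) * zchoose n (r - 2) - zchoose n (p - 2) * zchoose n (r - 1)) +
  zchoose n r * (zchoose n (p - 1) * zchoose n (q - 2) - zchoose n (p - 2) * zchoose n (q - 1))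

lemma tripleDet_self_left (n : ℕ) (p r : ℤ) : tripleDet n p p r = 0 := by
  unfold tripleDet; ring

lemma tripleDet_self_right (n : ℕ) (p r : ℤ) : tripleDet n p r r = 0 := by
  unfold tripleDet; ring

lemma tripleDet_of_neg (n : ℕ) {p : ℤ} (q r : ℤ) (h : p < 0) : tripleDet n p q r = 0 := by
  unfold tripleDet
  rw [zchoose_of_neg n h, zchoose_of_neg n (show p - 1 < 0 by omega),
    zchoose_of_neg n (show p - 2 < 0 by omega)]
  ring

/-- Pascal's rule splits each column in two, and the determinant is multilinear in its columns. The
terms are grouped by whether `q` moves, since this is what changes `k`. -/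
lemma tripleDet_succ (n : ℕ) (p q r : ℤ) :
    tripleDet (n + 1) p q r =
      tripleDet n p q r + tripleDet n (p - 1) q r +
      tripleDet n p q (r - 1) + tripleDet n (p - 1) q (r - 1) +
      (tripleDet n p (q - 1) r + tripleDet n (p - 1) (q - 1) r +
      tripleDet n p (q - 1) (r - 1) + tripleDet n (p - 1) (q - 1) (r - 1)) := by
  have e (x : ℤ) : x - 1 - 1 = x - 2 := by ring
  have e' (x : ℤ) : x - 2 - 1 = x - 1 - 2 := by ring
  unfold tripleDet
  simp only [zchoose_succ, e, e']
  ring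

/-- The sequence `0, f 0, f 1, …`. -/
def shift {M : Type*} [Zero M] (f : ℕ → M) : ℕ → M
  | 0 => 0
  | n + 1 => f n

@[simp] lemma shift_zero {M : Type*} [Zero M] (f : ℕ → M) : shift f 0 = 0 := rfl

@[simp] lemma shift_succ {M : Type*} [Zero M] (f : ℕ → M) (n : ℕ) : shift f (n + 1) = f n := rfl

lemma map_shift {M N : Type*} [AddCommGroup M] [AddCommGroup N] (Λ : M →+ N) (f : ℕ → M) (n : ℕ) :
    Λ (shift f n) = shift (fun n => Λ (f n)) n := by
  cases n <;> simp

/-- The number of walks of `n` steps in the quadrant from the origin to `(a, b)`, of which `k` steps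
lie in `{0, -1} × {0, 1}` and the other ones in `{0, 1} × {0, -1}`. -/
def quadrantWalks : ℕ → ℕ → ℕ → ℕ → ℤ
  | 0, k, a, b => if k = 0 ∧ a = 0 ∧ b = 0 then 1 else 0
  | n + 1, k, a, b =>
    shift (fun k => quadrantWalks n k a b + quadrantWalks n k (a + 1) b +
      shift (fun b => quadrantWalks n k a b + quadrantWalks n k (a + 1) b) b) k +
    (quadrantWalks n k a b + quadrantWalks n k a (b + 1) +
      shift (fun a => quadrantWalks n k a b + quadrantWalks n k a (b + 1)) a)

/-- The coordinates `a` and `b` are the gaps `r - q - 1` and `q - p - 1` between three path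
endpoints, and `k = q - 1`. A step that leaves the quadrant makes two columns coincide, so both
sides obey the same recursion, boundary included. -/
lemma quadrantWalks_eq_tripleDet (n k a b : ℕ) :
    quadrantWalks n k a b = tripleDet n (k - b) (k + 1) (k + a + 2) := by
  induction n generalizing k a b with
  | zero =>
    simp only [quadrantWalks, tripleDet, zchoose_zero]
    by_cases hb : b = 0
    · by_cases hk : k = 0
      · by_cases ha : a = 0
        · subst ha hb hk; norm_num
        · subst hb hk
          have h1 : ¬ ((a : ℤ) + 2 = 0) := by omega
          have h2 : ¬ ((a : ℤ) + 2 - 1 = 0) := by omega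
          have h3 : ¬ ((a : ℤ) + 2 - 2 = 0) := by omega
          simp [ha]
      · have h0 : ¬ ((k : ℤ) + a + 2 = 0) := by omega
        have h1 : ¬ ((k : ℤ) + a + 2 - 1 = 0) := by omega
        have h2 : ¬ ((k : ℤ) + a + 2 - 2 = 0) := by omega
        rw [if_neg h0, if_neg h1, if_neg h2, if_neg (by tauto)]
        ring
    · rw [if_neg (by tauto)]
      by_cases hka : k + a = 0
      · have h0 : ¬ ((k : ℤ) - b = 0) := by omega
        have h1 : ¬ ((k : ℤ) - b - 1 = 0) := by omega
        have h2 : ¬ ((k : ℤ) - b - 2 = 0) := by omega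
        rw [if_neg h0, if_neg h1, if_neg h2]
        ring
      · have h0 : ¬ ((k : ℤ) + a + 2 = 0) := by omega
        have h1 : ¬ ((k : ℤ) + a + 2 - 1 = 0) := by omega
        have h2 : ¬ ((k : ℤ) + a + 2 - 2 = 0) := by omega
        rw [if_neg h0, if_neg h1, if_neg h2]
        ring
  | succ n ih =>
    have hright : shift (fun a => quadrantWalks n k a b + quadrantWalks n k a (b + 1)) a =
        tripleDet n (k - b) (k + 1) (k + a + 2 - 1) +
        tripleDet n (k - b - 1) (k + 1) (k + a + 2 - 1) := by
      cases a with
      | zero =>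
        rw [show (k : ℤ) + (0 : ℕ) + 2 - 1 = k + 1 by push_cast; ring]
        simp only [tripleDet_self_right, add_zero, shift_zero]
      | succ a =>
        simp only [shift_succ, ih]
        push_cast
        ring_nf
    have hleft : shift (fun k => quadrantWalks n k a b + quadrantWalks n k (a + 1) b +
        shift (fun b => quadrantWalks n k a b + quadrantWalks n k (a + 1) b) b) k =
      (tripleDet n (k - b) (k + 1 - 1) (k + a + 2) +
        tripleDet n (k - b - 1) (k + 1 - 1) (k + a + 2) +
      tripleDet n (k - b) (k + 1 - 1) (k + a + 2 - 1) +
        tripleDet n (k - b - 1) (k + 1 - 1) (k + a + 2 - 1)) := by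
      cases k with
      | zero =>
        clear hright
        -- With `k = 0` no marked step is available. Each term vanishes because `p < 0` or, when `b
        -- = 0` and `p` stays put, because `p = q`.
        rw [tripleDet_of_neg n (p := ((0 : ℕ) : ℤ) - b - 1) _ _ (by omega),
          tripleDet_of_neg n (p := ((0 : ℕ) : ℤ) - b - 1) _ _ (by omega)]
        cases b with
        | zero =>
          norm_num
          simp only [tripleDet_self_left, add_zero]
        | succ b =>
          rw [tripleDet_of_neg n _ _ (by omega), tripleDet_of_neg n _ _ (by omega)]
          norm_num
      | succ k =>
        cases b with
        | zero =>
          simp only [shift_succ, shift_zero, ih]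
          push_cast
          rw [show (k : ℤ) + 1 + 1 - 1 = k + 1 by ring, show (k : ℤ) + 1 - 0 = k + 1 by ring,
            tripleDet_self_left, tripleDet_self_left]
          ring_nf
        | succ b =>
          simp only [shift_succ, ih]
          push_cast
          ring_nf
    rw [quadrantWalks, hright, hleft, ih, ih, tripleDet_succ]
    push_cast
    ring_nf

/-! ### Evaluation of the determinant at the origin -/

lemma zchoose_add_one (k l : ℕ) :
    (zchoose (k + l) ((k : ℤ) + 1) : ℚ) = (k + l).choose k * (l / (k + 1)) := by
  have h := Nat.choose_succ_right_eq (k + l) k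
  rw [Nat.add_sub_cancel_left] at h
  have h' : (((k + l).choose (k + 1) : ℕ) : ℚ) * (k + 1) = (k + l).choose k * l := by
    exact_mod_cast h
  rw [show (k : ℤ) + 1 = ((k + 1 : ℕ) : ℤ) by push_cast; ring, zchoose_natCast]
  push_cast
  field_simp
  linarith

lemma zchoose_sub_one (k l : ℕ) :
    (zchoose (k + l) ((k : ℤ) - 1) : ℚ) = (k + l).choose k * (k / (l + 1)) := by
  cases k with
  | zero => simp [zchoose_of_neg]
  | succ k =>
    have h := zchoose_add_one k (l + 1)
    rw [show k + 1 + l = k + (l + 1) by ring,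
      show ((k + 1 : ℕ) : ℤ) - 1 = (k : ℕ) by push_cast; ring, zchoose_natCast]
    rw [show (k : ℤ) + 1 = ((k + 1 : ℕ) : ℤ) by push_cast; ring, zchoose_natCast] at h
    push_cast at h ⊢
    rw [h]
    field_simp

lemma zchoose_add_two (k l : ℕ) :
    (zchoose (k + l) ((k : ℤ) + 2) : ℚ) =
      (k + l).choose k * (l * (l - 1) / ((k + 1) * (k + 2))) := by
  cases l with
  | zero =>
    rw [show (k : ℤ) + 2 = ((k + 2 : ℕ) : ℤ) by push_cast; ring, zchoose_natCast,
      Nat.choose_eq_zero_of_lt (by omega)]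
    simp
  | succ l =>
    have h := zchoose_add_one (k + 1) l
    have h' := zchoose_add_one k (l + 1)
    rw [show (k : ℤ) + 1 = ((k + 1 : ℕ) : ℤ) by push_cast; ring, zchoose_natCast] at h'
    rw [show ((k + 1 : ℕ) : ℤ) + 1 = k + 2 by push_cast; ring,
      show k + 1 + l = k + (l + 1) by ring] at h
    push_cast at h h' ⊢
    rw [h, h']
    field_simp
    ring

lemma zchoose_sub_two (k l : ℕ) :
    (zchoose (k + l) ((k : ℤ) - 2) : ℚ) =
      (k + l).choose k * (k * (k - 1) / ((l + 1) * (l + 2))) := by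
  cases k with
  | zero => simp [zchoose_of_neg]
  | succ k =>
    have h := zchoose_sub_one k (l + 1)
    have h' := zchoose_sub_one (k + 1) l
    rw [show ((k + 1 : ℕ) : ℤ) - 1 = (k : ℕ) by push_cast; ring, zchoose_natCast] at h'
    rw [show k + (l + 1) = k + 1 + l by ring] at h
    rw [show ((k + 1 : ℕ) : ℤ) - 2 = k - 1 by push_cast; ring, h]
    push_cast at h' ⊢
    rw [h']
    field_simp
    ring

/-- All entries, and all binomials in `theta`, are rational multiples of `C(k + l, k)`. What remains
is an identity of rational functions in `k` and `l`. -/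
lemma quadrantWalks_eq_theta (k l : ℕ) : (quadrantWalks (k + l) k 0 0 : ℚ) = theta k l := by
  have e0 : (zchoose (k + l) (k : ℤ) : ℚ) = (k + l).choose k := by rw [zchoose_natCast]; simp
  have c1 : ((k + l + 1).choose k : ℚ) = (k + l).choose k * ((k + l + 1) / (l + 1)) := by
    have h := Nat.choose_mul_succ_eq (k + l) k
    rw [show k + l + 1 - k = l + 1 by omega] at h
    have h' : ((k + l).choose k : ℚ) * (k + l + 1) = (k + l + 1).choose k * (l + 1) := by
      exact_mod_cast h
    field_simp
    linarith
  have c2 : ((k + l + 2).choose k : ℚ) = (k + l + 1).choose k * ((k + l + 2) / (l + 2)) := by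
    have h := Nat.choose_mul_succ_eq (k + l + 1) k
    rw [show k + l + 1 + 1 - k = l + 2 by omega] at h
    have h' : ((k + l + 1).choose k : ℚ) * (k + l + 2) = (k + l + 2).choose k * (l + 2) := by
      exact_mod_cast h
    field_simp
    linarith
  rw [quadrantWalks_eq_tripleDet, tripleDet, theta, c2, c1]
  rw [show (k : ℤ) - (0 : ℕ) = k by simp, show (k : ℤ) + (0 : ℕ) + 2 = k + 2 by simp,
    show (k : ℤ) + 1 - 1 = k by ring, show (k : ℤ) + 1 - 2 = k - 1 by ring,
    show (k : ℤ) + 2 - 1 = k + 1 by ring, show (k : ℤ) + 2 - 2 = k by ring]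
  push_cast
  rw [e0, zchoose_add_one, zchoose_add_two, zchoose_sub_one, zchoose_sub_two]
  field_simp
  ring

/-! ### The generating tree -/

/-- The sum of the values of `φ` at the labels of the children of a vertex with label `(d, i, j)`:
these are `(d + 1, x, j + 1)` for `x ≤ i` and `(d, i + 1, y)` for `y ≤ j`. -/
def childSum (φ : ℕ → ℕ → ℕ → ℤ) (d i j : ℕ) : ℤ :=
  ∑ x ∈ Finset.range (i + 1), φ (d + 1) x (j + 1) + ∑ y ∈ Finset.range (j + 1), φ d (i + 1) y

/-- The function `(d, i, j) ↦ C(i, a) C(j, b)` on labels with `d = k`, extended by zero. -/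
def binomialWeight (k a b d i j : ℕ) : ℤ :=
  if d = k then (i.choose a : ℤ) * (j.choose b : ℤ) else 0

lemma sum_range_choose_cast (i a : ℕ) :
    ∑ x ∈ Finset.range (i + 1), (x.choose a : ℤ) = i.choose a + i.choose (a + 1) := by
  induction i with
  | zero => cases a <;> simp
  | succ i ih =>
    rw [Finset.sum_range_succ, ih, Nat.choose_succ_succ i a]
    push_cast
    ring

lemma choose_succ_cast (j b : ℕ) :
    ((j + 1).choose b : ℤ) = j.choose b + shift (fun b => (j.choose b : ℤ)) b := by
  cases b with
  | zero => simp
  | succ b =>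
    rw [Nat.choose_succ_succ, shift_succ]
    push_cast
    ring

/-- The sum over `x ≤ i` raises `a` by the hockey-stick identity, and the increment of `j` lowers
`b` by Pascal's rule; the second family of children swaps the roles. The coefficients are exactly
those defining `quadrantWalks`. -/
lemma childSum_binomialWeight (k a b : ℕ) :
    childSum (binomialWeight k a b) =
      shift (fun k => binomialWeight k a b + binomialWeight k (a + 1) b +
        shift (fun b => binomialWeight k a b + binomialWeight k (a + 1) b) b) k +
      (binomialWeight k a b + binomialWeight k a (b + 1) +
        shift (fun a => binomialWeight k a b + binomialWeight k a (b + 1)) a) := by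
  funext d i j
  unfold childSum
  simp only [Pi.add_apply]
  congr 1
  · cases k with
    | zero => simp [binomialWeight]
    | succ k =>
      by_cases h : d = k
      · simp only [binomialWeight, h, if_true, ← Finset.sum_mul, sum_range_choose_cast,
          choose_succ_cast j b, shift_succ]
        cases b <;> simp [binomialWeight]; ring
      · cases b <;> simp [binomialWeight, h]
  · by_cases h : d = k
    · simp only [binomialWeight, h, if_true, ← Finset.mul_sum, sum_range_choose_cast,
          choose_succ_cast i a]
      cases a <;> simp [binomialWeight]; ring
    · cases a <;> simp [binomialWeight, h]

/-- Sums of binomial weights over the levels of a family that grows by the rule of `childSum`. -/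
theorem binomialWeight_sum_eq_quadrantWalks (Λ : ℕ → (ℕ → ℕ → ℕ → ℤ) →+ ℤ)
    (hzero : ∀ φ, Λ 0 φ = φ 0 0 0) (hsucc : ∀ n φ, Λ (n + 1) φ = Λ n (childSum φ))
    (n k a b : ℕ) : Λ n (binomialWeight k a b) = quadrantWalks n k a b := by
  induction n generalizing k a b with
  | zero =>
    rw [hzero, quadrantWalks, binomialWeight]
    cases k <;> cases a <;> cases b <;> simp
  | succ n ih =>
    rw [hsucc, childSum_binomialWeight, quadrantWalks]
    simp only [map_add, map_shift, ih]

lemma binomialWeight_zero_zero (k d i j : ℕ) :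
    binomialWeight k 0 0 d i j = if d = k then 1 else 0 := by
  simp [binomialWeight]

/-! ### Trees as forests -/

/-- The right subtrees of the vertices on the left branch of a tree, from bottom to top. -/
def unfold : FullBinaryTree → List FullBinaryTree
  | .nil => []
  | .node _ l r => unfold l ++ [r]

/-- The tree with given right subtrees along its left branch. -/
def fold (F : List FullBinaryTree) : FullBinaryTree :=
  F.foldl (fun l r => .node () l r) .nil

lemma fold_unfold (t : FullBinaryTree) : fold (unfold t) = t := by
  induction t with
  | nil => rfl
  | node v l r ihl _ =>
    unfold fold at ihl ⊢
    simp [Baxter.unfold, ihl]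

lemma unfold_fold (F : List FullBinaryTree) : unfold (fold F) = F := by
  induction F using List.reverseRecOn with
  | nil => rfl
  | append_singleton F r ih =>
    unfold fold at ih ⊢
    simp [Baxter.unfold, ih]

/-- The concatenation of the fingerprints of the trees of a forest, hung as right children. -/
def word (F : List FullBinaryTree) : List Bool := F.flatMap (childFingerprint false)

lemma word_append (F G : List FullBinaryTree) : word (F ++ G) = word F ++ word G := by
  simp [word]

lemma childFingerprint_true (t : FullBinaryTree) :
    childFingerprint true t = true :: word (unfold t) := by
  induction t with
  | nil => rfl
  | node v l r ihl _ => simp [childFingerprint, unfold, word_append, ihl]; simp [word]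

/-- The leftmost leaf of an inner vertex is a left leaf, whichever side the vertex itself hangs on.
-/
lemma childFingerprint_node (isLeft : Bool) (v : Unit) (l r : FullBinaryTree) :
    childFingerprint isLeft (.node v l r) = true :: word (unfold (.node v l r)) := by
  rw [childFingerprint, childFingerprint_true, unfold, word_append]
  simp [word]

lemma childFingerprint_false_fold {F : List FullBinaryTree} (hF : F ≠ []) :
    childFingerprint false (fold F) = true :: word F := by
  conv_rhs => rw [← unfold_fold F]
  cases h : fold F with
  | nil => exact absurd (by rw [← unfold_fold F, h]; rfl) hF
  | node v l r => exact childFingerprint_node _ _ _ _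

/-- The forests with a given word. -/
def forests : List Bool → Finset (List FullBinaryTree)
  | [] => {[]}
  | false :: w => (forests w).image (.nil :: ·)
  | true :: w => ((forests w).sigma fun F => Finset.range F.length).image
      fun p => fold (p.1.take (p.1.length - p.2)) :: p.1.drop (p.1.length - p.2)

lemma childFingerprint_ne_nil (b : Bool) (t : FullBinaryTree) : childFingerprint b t ≠ [] := by
  cases t with
  | nil => simp [childFingerprint]
  | node v l r => simp [childFingerprint_node]

/-- A leading `false` means that the first tree is a leaf. A leading `true` is the leftmost leaf of
a first tree that is not a leaf; deleting it splices the right subtrees along that tree's left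
branch into the forest. Conversely, any nonempty prefix may be folded up. -/
lemma mem_forests {w : List Bool} {F : List FullBinaryTree} : F ∈ forests w ↔ word F = w := by
  induction w generalizing F with
  | nil =>
    cases F with
    | nil => simp [forests, word]
    | cons t F => simp [forests, word, childFingerprint_ne_nil]
  | cons c w ih =>
    cases c with
    | false =>
      simp only [forests, Finset.mem_image, ih]
      constructor
      · rintro ⟨F, rfl, rfl⟩
        simp [word, childFingerprint]
      · cases F with
        | nil => simp [word]
        | cons t F =>
          cases t with
          | nil => intro h; exact ⟨F, by simpa [word, childFingerprint] using h, rfl⟩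
          | node v l r => simp [word, childFingerprint_node]
    | true =>
      simp only [forests, Finset.mem_image, Finset.mem_sigma, ih, Finset.mem_range, Sigma.exists]
      constructor
      · rintro ⟨F, a, ⟨rfl, ha⟩, rfl⟩
        have hne : F.take (F.length - a) ≠ [] := by
          rw [Ne, List.take_eq_nil_iff]
          rintro (h | h)
          · omega
          · simp [h] at ha
        rw [word, List.flatMap_cons, childFingerprint_false_fold hne, List.cons_append]
        congr 1
        change _ ++ word _ = _
        rw [← word_append, List.take_append_drop]
      · cases F with
        | nil => simp [word]
        | cons t F =>
          cases t with
          | nil => simp [word, childFingerprint]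
          | node v l r =>
            intro h
            -- The second witness counts the trees left outside the folded prefix.
            refine ⟨unfold (.node v l r) ++ F, F.length, ⟨?_, ?_⟩, ?_⟩
            · rw [word, List.flatMap_cons, childFingerprint_node] at h
              rw [word_append]
              simpa [word] using h
            · simp [unfold]
              omega
            · simp [fold_unfold]

/-! ### Growth of forests and of pairs of trees -/

lemma sum_forests_false (w : List Bool) (φ : ℕ → ℤ) :
    ∑ F ∈ forests (false :: w), φ F.length = ∑ F ∈ forests w, φ (F.length + 1) := by
  rw [forests, Finset.sum_image (by intro F _ G _ h; simpa using h)]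
  simp

/-- If `x` trees stay outside the folded prefix, the new forest has `x + 1` trees; nonemptiness of
the prefix is `x < F.length`. -/
lemma sum_forests_true (w : List Bool) (φ : ℕ → ℤ) :
    ∑ F ∈ forests (true :: w), φ F.length =
      ∑ F ∈ forests w, ∑ x ∈ Finset.range F.length, φ (x + 1) := by
  rw [forests, Finset.sum_image, Finset.sum_sigma]
  · refine Finset.sum_congr rfl fun F _ => Finset.sum_congr rfl fun x hx => ?_
    rw [Finset.mem_range] at hx
    congr 1
    simp
    omega
  · rintro ⟨F, x⟩ hF ⟨G, y⟩ hG h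
    simp only [Finset.coe_sigma, Set.mem_sigma_iff, Finset.coe_range, Set.mem_Iio] at hF hG
    simp only [List.cons.injEq] at h
    have h1 : F.take (F.length - x) = G.take (G.length - y) := by
      rw [← unfold_fold (F.take _), h.1, unfold_fold]
    have hFG : F = G := by
      rw [← List.take_append_drop (F.length - x) F, h1, h.2, List.take_append_drop]
    subst hFG
    have h2 := congrArg List.length h.2
    simp only [List.length_drop] at h2
    obtain rfl : x = y := by omega
    rfl

lemma length_pos_of_mem_forests {w : List Bool} {F : List FullBinaryTree} (hw : w ≠ [])
    (hF : F ∈ forests w) : 0 < F.length := by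
  rw [mem_forests] at hF
  rw [List.length_pos_iff]
  rintro rfl
  exact hw hF.symm

/-- The sum of the values of `φ` at the numbers of vertices below the root on the left branch, for
all trees with reduced fingerprint `α`. -/
def treeSum (α : List Bool) (φ : ℕ → ℤ) : ℤ :=
  ∑ F ∈ forests (α ++ [false]), φ (F.length - 1)

lemma treeSum_nil (φ : ℕ → ℤ) : treeSum [] φ = φ 0 := by
  simp [treeSum, forests]

lemma treeSum_false (α : List Bool) (φ : ℕ → ℤ) :
    treeSum (false :: α) φ = treeSum α (fun i => φ (i + 1)) := by
  rw [treeSum, List.cons_append, sum_forests_false _ fun i => φ (i - 1)]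
  refine Finset.sum_congr rfl fun F hF => ?_
  have := length_pos_of_mem_forests (by simp) hF
  congr 1
  omega

lemma treeSum_true (α : List Bool) (φ : ℕ → ℤ) :
    treeSum (true :: α) φ = treeSum α (fun i => ∑ x ∈ Finset.range (i + 1), φ x) := by
  rw [treeSum, List.cons_append, sum_forests_true _ fun i => φ (i - 1)]
  refine Finset.sum_congr rfl fun F hF => ?_
  have := length_pos_of_mem_forests (by simp) hF
  change _ = ∑ x ∈ Finset.range (F.length - 1 + 1), φ x
  rw [Nat.sub_add_cancel this]
  simp

lemma treeSum_sum {ι : Type*} (s : Finset ι) (α : List Bool) (φ : ι → ℕ → ℤ) :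
    treeSum α (fun i => ∑ x ∈ s, φ x i) = ∑ x ∈ s, treeSum α (φ x) :=
  Finset.sum_comm

lemma treeSum_add (α : List Bool) (φ ψ : ℕ → ℤ) :
    treeSum α (fun i => φ i + ψ i) = treeSum α φ + treeSum α ψ :=
  Finset.sum_add_distrib

/-- The words of length `n`. -/
def boolWords : ℕ → Finset (List Bool)
  | 0 => {[]}
  | n + 1 => (boolWords n).image (true :: ·) ∪ (boolWords n).image (false :: ·)

lemma mem_boolWords {n : ℕ} {w : List Bool} : w ∈ boolWords n ↔ w.length = n := by
  induction n generalizing w with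
  | zero => simp [boolWords]
  | succ n ih =>
    cases w with
    | nil => simp [boolWords]
    | cons c w => cases c <;> simp [boolWords, ih]

lemma sum_boolWords_succ (n : ℕ) (f : List Bool → ℤ) :
    ∑ w ∈ boolWords (n + 1), f w =
      ∑ w ∈ boolWords n, f (true :: w) + ∑ w ∈ boolWords n, f (false :: w) := by
  rw [boolWords, Finset.sum_union, Finset.sum_image (by intro F _ G _ h; simpa using h),
    Finset.sum_image (by intro F _ G _ h; simpa using h)]
  rw [Finset.disjoint_left]
  simp

/-- The sum of `φ` over pairs of trees with complementary reduced fingerprints. -/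
def twinSum (n : ℕ) : (ℕ → ℕ → ℕ → ℤ) →+ ℤ :=
  AddMonoidHom.mk' (fun φ => ∑ α ∈ boolWords n,
      treeSum α fun i => treeSum (α.map not) fun j => φ (α.count true) i j) (by
    intro φ ψ
    simp only [Pi.add_apply, treeSum_add, Finset.sum_add_distrib])

lemma twinSum_apply (n : ℕ) (φ : ℕ → ℕ → ℕ → ℤ) :
    twinSum n φ = ∑ α ∈ boolWords n,
      treeSum α fun i => treeSum (α.map not) fun j => φ (α.count true) i j := rfl

lemma twinSum_zero (φ : ℕ → ℕ → ℕ → ℤ) : twinSum 0 φ = φ 0 0 0 := by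
  simp [twinSum_apply, boolWords, treeSum_nil]

/-- A new first letter `true` raises `d`, sends `i` to any `x ≤ i`, and is `false` for the second
tree, sending `j` to `j + 1`. The letter `false` gives the other children. -/
lemma twinSum_succ (n : ℕ) (φ : ℕ → ℕ → ℕ → ℤ) : twinSum (n + 1) φ = twinSum n (childSum φ) := by
  simp only [twinSum_apply, sum_boolWords_succ, ← Finset.sum_add_distrib]
  refine Finset.sum_congr rfl fun α _ => ?_
  simp [childSum, treeSum_true, treeSum_false, treeSum_add, treeSum_sum]

/-- The trees with reduced fingerprint `α`, other than the single leaf. -/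
def treesWithFingerprint (α : List Bool) : Finset FullBinaryTree :=
  (forests (α ++ [false])).image fold

/-! ### From forests back to twin pairs -/

lemma fingerprint_node (v : Unit) (l r : FullBinaryTree) :
    fingerprint (.node v l r) = true :: word (unfold (.node v l r)) :=
  childFingerprint_node true v l r

lemma childFingerprint_false_getLast (t : FullBinaryTree) :
    ∃ w, childFingerprint false t = w ++ [false] := by
  induction t with
  | nil => exact ⟨[], rfl⟩
  | node v l r _ ihr =>
    obtain ⟨w, hw⟩ := ihr
    exact ⟨childFingerprint true l ++ w, by simp [childFingerprint, hw]⟩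

lemma fingerprint_eq_of_ne_nil {T : FullBinaryTree} (hT : T ≠ .nil) :
    fingerprint T = true :: (reducedFingerprint T ++ [false]) := by
  cases T with
  | nil => exact absurd rfl hT
  | node v l r =>
    obtain ⟨w, hw⟩ := childFingerprint_false_getLast r
    have h : fingerprint (.node v l r) = true :: ((word (unfold l) ++ w) ++ [false]) := by
      rw [fingerprint, childFingerprint_true, hw]
      simp
    rw [reducedFingerprint, h]
    simp

lemma mem_treesWithFingerprint {α : List Bool} {T : FullBinaryTree} :
    T ∈ treesWithFingerprint α ↔ T ≠ .nil ∧ reducedFingerprint T = α := by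
  simp only [treesWithFingerprint, Finset.mem_image, mem_forests]
  constructor
  · rintro ⟨F, hF, rfl⟩
    have hne : fold F ≠ .nil := by
      intro h
      have : F = [] := by rw [← unfold_fold F, h]; rfl
      subst this
      simp [word] at hF
    refine ⟨hne, ?_⟩
    have h := fingerprint_eq_of_ne_nil hne
    cases hT : fold F with
    | nil => exact absurd hT hne
    | node v l r =>
      rw [hT, fingerprint_node, ← hT, unfold_fold, hF] at h
      rw [← hT]
      simpa using h.symm
  · rintro ⟨hne, rfl⟩
    refine ⟨unfold T, ?_, fold_unfold T⟩
    have h := fingerprint_eq_of_ne_nil hne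
    cases T with
    | nil => exact absurd rfl hne
    | node v l r => rw [fingerprint_node] at h; simpa using h

lemma card_treesWithFingerprint (α : List Bool) :
    ((treesWithFingerprint α).card : ℤ) = treeSum α fun _ => 1 := by
  rw [treesWithFingerprint, Finset.card_image_of_injective _
    (Function.LeftInverse.injective unfold_fold)]
  simp [treeSum]

/-- The mirror image of a tree. -/
def mirror : FullBinaryTree → FullBinaryTree
  | .nil => .nil
  | .node v l r => .node v (mirror r) (mirror l)

lemma mirror_mirror (T : FullBinaryTree) : mirror (mirror T) = T := by
  induction T with
  | nil => rfl
  | node v l r ihl ihr => simp [mirror, ihl, ihr]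

lemma childFingerprint_mirror (b : Bool) (T : FullBinaryTree) :
    childFingerprint b (mirror T) = ((childFingerprint (!b) T).map not).reverse := by
  induction T generalizing b with
  | nil => simp [mirror, childFingerprint]
  | node v l r ihl ihr => simp [mirror, childFingerprint, ihl, ihr]

lemma fingerprint_mirror (T : FullBinaryTree) :
    fingerprint (mirror T) = ((fingerprint T).map not).reverse := by
  cases T with
  | nil => rfl
  | node v l r => simp [mirror, fingerprint, childFingerprint_mirror]

lemma mirror_ne_nil {T : FullBinaryTree} : mirror T ≠ .nil ↔ T ≠ .nil := by
  cases T <;> simp [mirror]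

lemma reducedFingerprint_mirror (T : FullBinaryTree) :
    reducedFingerprint (mirror T) = ((reducedFingerprint T).map not).reverse := by
  by_cases hT : T = .nil
  · subst hT; rfl
  · have h := fingerprint_mirror T
    rw [fingerprint_eq_of_ne_nil hT, fingerprint_eq_of_ne_nil (mirror_ne_nil.2 hT)] at h
    simpa using h

lemma leftLeaves_of_ne_nil {T : FullBinaryTree} (hT : T ≠ .nil) :
    leftLeaves T = (reducedFingerprint T).count true + 1 := by
  rw [leftLeaves, fingerprint_eq_of_ne_nil hT]
  simp

lemma rightLeaves_of_ne_nil {T : FullBinaryTree} (hT : T ≠ .nil) :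
    rightLeaves T = (reducedFingerprint T).count false + 1 := by
  rw [rightLeaves, fingerprint_eq_of_ne_nil hT]
  simp

lemma ne_nil_of_leftLeaves {T : FullBinaryTree} {k : ℕ} (h : leftLeaves T = k + 1) : T ≠ .nil := by
  rintro rfl
  simp [leftLeaves, fingerprint] at h

lemma count_true_add_count_false (w : List Bool) : w.count true + w.count false = w.length := by
  induction w with
  | nil => rfl
  | cons c w ih => cases c <;> simp <;> omega

/-- Mirroring reverses and complements the reduced fingerprint, so `(A, B)` is a twin pair exactly
when `A` and `mirror B` have complementary ones. The single leaf, whose reduced fingerprint is also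
empty, is excluded because it has no left leaf. -/
lemma twinPairs_eq (k l : ℕ) :
    twinPairs (k + 1) (l + 1) = ((((boolWords (k + l)).filter fun α => α.count true = k).biUnion
      fun α => treesWithFingerprint α ×ˢ (treesWithFingerprint (α.map not)).image mirror :
        Finset (FullBinaryTree × FullBinaryTree)) : Set (FullBinaryTree × FullBinaryTree)) := by
  ext ⟨A, B⟩
  simp only [twinPairs, IsTwinPair, Set.mem_ofPred_eq, Finset.coe_biUnion, Finset.coe_filter,
    Set.mem_iUnion, Finset.mem_coe, Finset.mem_product, mem_treesWithFingerprint,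
    Finset.mem_image, mem_boolWords, exists_prop]
  constructor
  · rintro ⟨hAB, ⟨hA, hA'⟩, ⟨hB, hB'⟩⟩
    have hAn := ne_nil_of_leftLeaves hA
    have hBn := ne_nil_of_leftLeaves hB
    rw [leftLeaves_of_ne_nil hAn] at hA
    rw [rightLeaves_of_ne_nil hAn] at hA'
    have := count_true_add_count_false (reducedFingerprint A)
    refine ⟨reducedFingerprint A, ⟨by omega, by omega⟩, ⟨hAn, rfl⟩, mirror B,
      ⟨mirror_ne_nil.2 hBn, ?_⟩, mirror_mirror B⟩
    rw [reducedFingerprint_mirror, hAB, List.map_reverse]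
  · rintro ⟨α, ⟨hn, hk⟩, ⟨hAn, rfl⟩, B', ⟨hBn, hB⟩, rfl⟩
    have := count_true_add_count_false (reducedFingerprint A)
    have hBA : reducedFingerprint (mirror B') = (reducedFingerprint A).reverse := by
      rw [reducedFingerprint_mirror, hB]
      simp [Function.comp_def]
    rw [leftLeaves_of_ne_nil hAn, rightLeaves_of_ne_nil hAn,
      leftLeaves_of_ne_nil (mirror_ne_nil.2 hBn), rightLeaves_of_ne_nil (mirror_ne_nil.2 hBn), hBA]
    simp only [List.reverse_reverse, List.count_reverse, true_and]
    omega

theorem finite_twinPairs (k l : ℕ) : (twinPairs (k + 1) (l + 1)).Finite := by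
  rw [twinPairs_eq]
  exact Finset.finite_toSet _

theorem ncard_twinPairs (k l : ℕ) : ((twinPairs (k + 1) (l + 1)).ncard : ℚ) = theta k l := by
  have h := binomialWeight_sum_eq_quadrantWalks twinSum twinSum_zero twinSum_succ (k + l) k 0 0
  rw [← quadrantWalks_eq_theta, ← h, twinPairs_eq, Set.ncard_coe_finset, Finset.card_biUnion]
  · rw [← Int.cast_natCast]
    congr 1
    simp only [twinSum_apply, binomialWeight_zero_zero, Finset.card_product,
      Finset.card_image_of_injective _ (Function.LeftInverse.injective mirror_mirror)]
    push_cast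
    rw [Finset.sum_filter]
    refine Finset.sum_congr rfl fun α _ => ?_
    split_ifs
    · rw [card_treesWithFingerprint, card_treesWithFingerprint]
      simp [treeSum]
    · simp [treeSum]
  · intro α _ β _ hαβ
    rw [Function.onFun, Finset.disjoint_left]
    rintro ⟨A, B⟩ hA hB
    rw [Finset.mem_product, mem_treesWithFingerprint] at hA hB
    exact hαβ (hA.1.2.symm.trans hB.1.2)

/-! ### Baxter permutations as lists -/

/-- The number of descents of a list. -/
def descentCount : List ℕ → ℕ
  | x :: y :: L => (if y < x then 1 else 0) + descentCount (y :: L)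
  | _ => 0

lemma descentCount_append (L K : List ℕ) (x : ℕ) :
    descentCount (L ++ x :: K) = descentCount (L ++ [x]) + descentCount (x :: K) := by
  induction L with
  | nil => simp [descentCount]
  | cons y L ih =>
    cases L with
    | nil => simp [descentCount]
    | cons z L =>
      simp only [List.cons_append, descentCount] at ih ⊢
      omega

lemma descentCount_reverse {L : List ℕ} (hL : L.Nodup) (hne : L ≠ []) :
    descentCount L.reverse + descentCount L + 1 = L.length := by
  induction L with
  | nil => exact absurd rfl hne
  | cons x L ih =>
    cases L with
    | nil => simp [descentCount]
    | cons y L =>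
      have ih := ih hL.of_cons (by simp)
      have hxy : x ≠ y := by
        rintro rfl
        simp at hL
      simp only [List.reverse_cons, List.append_assoc, List.cons_append, List.nil_append] at ih ⊢
      rw [descentCount_append]
      simp only [descentCount, List.length_cons] at ih ⊢
      rcases lt_or_gt_of_ne hxy with h | h
      · simp only [h, h.not_gt, if_true, if_false]; omega
      · simp only [h, h.not_gt, if_true, if_false]; omega

/-- The number of right-to-left maxima of a list. -/
def rlMaxima : List ℕ → ℕ
  | [] => 0
  | x :: L => rlMaxima L + if ∀ y ∈ L, y < x then 1 else 0

lemma rlMaxima_append_cons {K : List ℕ} {x : ℕ} (R : List ℕ) (h : ∀ y ∈ K, y < x) :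
    rlMaxima (K ++ x :: R) = rlMaxima (x :: R) := by
  induction K with
  | nil => rfl
  | cons y K ih =>
    rw [List.cons_append, rlMaxima, ih fun z hz => h z (List.mem_cons_of_mem _ hz), if_neg]
    · rfl
    · intro H
      exact (H x (by simp)).not_gt (h y (by simp))

lemma rlMaxima_pos {L : List ℕ} (hL : L ≠ []) : 0 < rlMaxima L := by
  induction L with
  | nil => exact absurd rfl hL
  | cons x L ih =>
    cases L with
    | nil => simp [rlMaxima]
    | cons y L =>
      have := ih (by simp)
      rw [rlMaxima]
      omega

/-- The lists obtained from `L` by inserting `m` directly after a right-to-left maximum. -/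
def insertAfterMaxima (m : ℕ) : List ℕ → List (List ℕ)
  | [] => []
  | x :: L => (insertAfterMaxima m L).map (x :: ·) ++ if ∀ y ∈ L, y < x then [x :: m :: L] else []

lemma mem_insertAfterMaxima {m : ℕ} {L M : List ℕ} : M ∈ insertAfterMaxima m L ↔
    ∃ L₁ x L₂, L = L₁ ++ x :: L₂ ∧ (∀ y ∈ L₂, y < x) ∧ M = L₁ ++ x :: m :: L₂ := by
  induction L generalizing M with
  | nil => simp [insertAfterMaxima]
  | cons z L ih =>
    simp only [insertAfterMaxima, List.mem_append, List.mem_map, ih]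
    constructor
    · rintro (⟨_, ⟨L₁, x, L₂, rfl, h, rfl⟩, rfl⟩ | h)
      · exact ⟨z :: L₁, x, L₂, rfl, h, rfl⟩
      · split_ifs at h with hz
        · exact ⟨[], z, L, rfl, hz, by simpa using h⟩
        · simp at h
    · rintro ⟨L₁, x, L₂, hL, h, rfl⟩
      cases L₁ with
      | nil =>
        simp only [List.nil_append, List.cons.injEq] at hL
        obtain ⟨rfl, rfl⟩ := hL
        right
        rw [if_pos h]
        simp
      | cons y L₁ =>
        simp only [List.cons_append, List.cons.injEq] at hL
        obtain ⟨rfl, rfl⟩ := hL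
        exact Or.inl ⟨_, ⟨L₁, x, L₂, rfl, h, rfl⟩, rfl⟩

/-- After the insertion only `m` and the maxima to its right survive, so the insertion sites, from
right to left, leave 1, 2, … of them. -/
lemma map_rlMaxima_insertAfterMaxima {m : ℕ} {L : List ℕ} (hL : ∀ x ∈ L, x < m) :
    (insertAfterMaxima m L).map rlMaxima = (List.range (rlMaxima L)).map (· + 1) := by
  induction L with
  | nil => rfl
  | cons x L ih =>
    have hx : x < m := hL x (by simp)
    have hL' : ∀ y ∈ L, y < m := fun y hy => hL y (List.mem_cons_of_mem _ hy)
    have h : (insertAfterMaxima m L).map (rlMaxima ∘ (x :: ·)) =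
        (insertAfterMaxima m L).map rlMaxima := by
      refine List.map_congr_left fun M hM => ?_
      obtain ⟨L₁, y, L₂, rfl, _, rfl⟩ := mem_insertAfterMaxima.1 hM
      rw [Function.comp_apply, rlMaxima, if_neg, add_zero]
      intro H
      exact (H m (by simp)).not_gt hx
    rw [insertAfterMaxima, List.map_append, List.map_map, h, ih hL', rlMaxima]
    split_ifs with hmax
    · have h1 : rlMaxima (x :: m :: L) = rlMaxima L + 1 := by
        rw [rlMaxima, rlMaxima, if_pos hL', if_neg]
        intro H
        exact (H m (by simp)).not_gt hx
      rw [List.range_succ, List.map_append]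
      simp [h1]
    · simp

lemma nodup_insertAfterMaxima {m : ℕ} {L : List ℕ} (hL : ∀ x ∈ L, x < m) :
    (insertAfterMaxima m L).Nodup := by
  apply List.Nodup.of_map rlMaxima
  rw [map_rlMaxima_insertAfterMaxima hL]
  exact List.nodup_range.map (add_left_injective 1)

section Children

variable {m : ℕ} {L M : List ℕ}

/-- The right-to-left maximum `x` is last or is followed by a descent; the insertion appends a rise
or puts a rise before that descent. -/
lemma descentCount_of_mem_insertAfterMaxima (hL : ∀ x ∈ L, x < m)
    (hM : M ∈ insertAfterMaxima m L) : descentCount M = descentCount L := by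
  obtain ⟨L₁, x, L₂, rfl, hx, rfl⟩ := mem_insertAfterMaxima.1 hM
  have hxm : x < m := hL x (by simp)
  rw [descentCount_append, descentCount_append L₁ L₂]
  congr 1
  cases L₂ with
  | nil => simp [descentCount, hxm.not_gt]
  | cons y L₂ =>
    have h1 : y < x := hx y (by simp)
    simp [descentCount, hxm.not_gt, h1, h1.trans hxm]

/-- Entries after `x` are smaller than `x`, hence never left-to-right maxima. So `m` hides none and
adds one. -/
lemma rlMaxima_reverse_of_mem_insertAfterMaxima (hL : ∀ x ∈ L, x < m)
    (hM : M ∈ insertAfterMaxima m L) : rlMaxima M.reverse = rlMaxima L.reverse + 1 := by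
  obtain ⟨L₁, x, L₂, rfl, hx, rfl⟩ := mem_insertAfterMaxima.1 hM
  have h1 : (L₁ ++ x :: m :: L₂).reverse = L₂.reverse ++ m :: x :: L₁.reverse := by simp
  have h2 : (L₁ ++ x :: L₂).reverse = L₂.reverse ++ x :: L₁.reverse := by simp
  rw [h1, h2, rlMaxima_append_cons (x := x) _ (by simpa using hx), rlMaxima_append_cons, rlMaxima,
    if_pos]
  · intro y hy
    apply hL
    simp only [List.mem_cons, List.mem_reverse] at hy
    simp only [List.mem_append, List.mem_cons]
    tauto
  · intro y hy
    apply hL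
    simp only [List.mem_reverse] at hy
    simp [hy]

lemma perm_of_mem_insertAfterMaxima (hM : M ∈ insertAfterMaxima m L) : M.Perm (m :: L) := by
  obtain ⟨L₁, x, L₂, rfl, hx, rfl⟩ := mem_insertAfterMaxima.1 hM
  have h : L₁ ++ x :: m :: L₂ = (L₁ ++ [x]) ++ m :: L₂ := by simp
  rw [h]
  refine List.perm_middle.trans ?_
  simp

lemma filter_of_mem_insertAfterMaxima (hL : ∀ x ∈ L, x < m)
    (hM : M ∈ insertAfterMaxima m L) : M.filter (· < m) = L := by
  obtain ⟨L₁, x, L₂, rfl, hx, rfl⟩ := mem_insertAfterMaxima.1 hM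
  have h : (L₁ ++ x :: m :: L₂).filter (· < m) = (L₁ ++ x :: L₂).filter (· < m) := by
    simp [List.filter_append, List.filter_cons]
  rw [h, List.filter_eq_self]
  simpa using hL

end Children

/-- The list form of the Baxter condition. -/
def IsBaxterList (L : List ℕ) : Prop :=
  ∀ L₁ x y L₂, L = L₁ ++ x :: y :: L₂ → ∀ u ∈ L₁, ∀ w ∈ L₂,
    ¬ (y < u ∧ u < w ∧ w < x) ∧ ¬ (x < w ∧ w < u ∧ u < y)

lemma IsBaxterList.reverse {L : List ℕ} (h : IsBaxterList L) : IsBaxterList L.reverse := by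
  intro L₁ x y L₂ hL u hu w hw
  have := h L₂.reverse y x L₁.reverse (by rw [← List.reverse_reverse L, hL]; simp) w (by simpa)
    u (by simpa)
  tauto

lemma IsBaxterList.of_insert {L₁ L₂ : List ℕ} {m : ℕ} (h : IsBaxterList (L₁ ++ m :: L₂))
    (hm : ∀ z ∈ L₁ ++ L₂, z < m) : IsBaxterList (L₁ ++ L₂) := by
  intro K₁ x y K₂ hL u hu w hw
  have hum : u < m := hm u (by rw [hL]; simp [hu])
  have hwm : w < m := hm w (by rw [hL]; simp [hw])
  rcases List.append_eq_append_iff.1 hL with ⟨A, rfl, hA⟩ | ⟨A, rfl, hA⟩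
  · refine h (L₁ ++ m :: A) x y K₂ (by simp [hA]) u ?_ w hw
    simp only [List.mem_append, List.mem_cons] at hu ⊢
    tauto
  · match A, hA with
    | [], hA =>
      refine h (K₁ ++ [m]) x y K₂ ?_ u (by simp [hu]) w hw
      simp only [List.nil_append] at hA
      simp [← hA]
    -- The maximum separated `x` and `y`. A forbidden pattern on `x, y` persists with `m` in the
    -- role of the larger of the two.
    | [_], hA =>
      simp only [List.cons_append, List.nil_append, List.cons.injEq] at hA
      obtain ⟨rfl, rfl⟩ := hA
      have h1 := h (K₁ ++ [x]) m y K₂ (by simp) u (by simp [hu]) w hw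
      have h2 := h K₁ x m (y :: K₂) (by simp) u hu w (by simp [hw])
      tauto
    | _ :: _ :: A, hA =>
      simp only [List.cons_append, List.cons.injEq] at hA
      obtain ⟨rfl, rfl, rfl⟩ := hA
      refine h K₁ x y (A ++ m :: L₂) (by simp) u hu w ?_
      simp only [List.mem_append, List.mem_cons] at hw ⊢
      tauto

/-- The maximum can only play the largest entry of a pattern, hence one of the adjacent two. The
pair `x, m` would need a later entry above `x`; a pattern on `m` and its successor would already
occur with `x` in place of `m`. -/
lemma IsBaxterList.insert {L₁ L₂ : List ℕ} {x m : ℕ} (h : IsBaxterList (L₁ ++ x :: L₂))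
    (hm : ∀ z ∈ L₁ ++ x :: L₂, z < m) (hx : ∀ z ∈ L₂, z < x) :
    IsBaxterList (L₁ ++ x :: m :: L₂) := by
  intro K₁ p q K₂ hL u hu w hw
  have hm' : ∀ z ∈ L₁ ++ x :: m :: L₂, z ≤ m := by
    intro z hz
    simp only [List.mem_append, List.mem_cons] at hz hm
    rcases hz with hz | hz | hz | hz
    · exact (hm z (by tauto)).le
    · exact (hm z (by tauto)).le
    · exact hz.le
    · exact (hm z (by tauto)).le
  have hum : u ≤ m := hm' u (by rw [hL]; simp [hu])
  have hwm : w ≤ m := hm' w (by rw [hL]; simp [hw])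
  have hpm : p ≤ m := hm' p (by rw [hL]; simp)
  have hqm : q ≤ m := hm' q (by rw [hL]; simp)
  rcases List.append_eq_append_iff.1 hL with ⟨A, rfl, hA⟩ | ⟨A, rfl, hA⟩
  · match A, hA with
    | [], hA =>
      simp only [List.nil_append, List.cons.injEq] at hA
      obtain ⟨rfl, rfl, rfl⟩ := hA
      have := hx w hw
      omega
    | [_], hA =>
      simp only [List.cons_append, List.nil_append, List.cons.injEq] at hA
      obtain ⟨rfl, rfl, rfl⟩ := hA
      simp only [List.mem_append, List.mem_singleton] at hu
      have hwx := hx w (by simp [hw])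
      rcases hu with hu | rfl
      · have := h L₁ x q K₂ rfl u hu w hw
        omega
      · omega
    | _ :: _ :: A, hA =>
      simp only [List.cons_append, List.cons.injEq] at hA
      obtain ⟨rfl, rfl, rfl⟩ := hA
      simp only [List.mem_append, List.mem_cons] at hu
      by_cases hum' : u = m
      · omega
      · refine h (L₁ ++ x :: A) p q K₂ (by simp) u ?_ w hw
        simp only [List.mem_append, List.mem_cons]
        tauto
  · match A, hA with
    | [], hA =>
      simp only [List.nil_append, List.cons.injEq] at hA
      obtain ⟨rfl, rfl, rfl⟩ := hA
      have := hx w hw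
      omega
    | [_], hA =>
      simp only [List.cons_append, List.nil_append, List.cons.injEq] at hA
      obtain ⟨rfl, rfl, rfl⟩ := hA
      simp only [List.mem_cons] at hw
      rcases hw with rfl | hw
      · omega
      · have h1 := hx w hw
        have := h K₁ p q L₂ (by simp) u hu w hw
        omega
    | _ :: _ :: A, hA =>
      simp only [List.cons_append, List.cons.injEq] at hA
      obtain ⟨rfl, rfl, rfl⟩ := hA
      simp only [List.mem_append, List.mem_cons] at hw
      by_cases hwm' : w = m
      · omega
      · refine h K₁ p q (A ++ x :: L₂) (by simp) u hu w ?_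
        simp only [List.mem_append, List.mem_cons]
        tauto

lemma IsBaxterList.next_to_maximum {L₁ L₂ : List ℕ} {m : ℕ} (h : IsBaxterList (L₁ ++ m :: L₂))
    (hm : ∀ z ∈ L₁ ++ L₂, z < m) (hnd : (L₁ ++ L₂).Nodup) (hne : L₁ ++ L₂ ≠ []) :
    (∃ K x, L₁ = K ++ [x] ∧ ∀ w ∈ L₂, w < x) ∨ (∃ y K, L₂ = y :: K ∧ ∀ u ∈ L₁, u < y) := by
  obtain ⟨z, hz, hmax⟩ := (L₁ ++ L₂).toFinset.exists_max_image id
    (List.toFinset_nonempty_iff _ |>.2 hne)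
  simp only [List.mem_toFinset, id] at hz hmax
  have hne' : ∀ u ∈ L₁, ∀ w ∈ L₂, u ≠ w := (List.nodup_append.1 hnd).2.2
  have hzm := hm z hz
  rcases List.mem_append.1 hz with hz | hz
  · left
    obtain rfl | ⟨K, x, rfl⟩ := List.eq_nil_or_concat L₁
    · simp at hz
    · rw [List.concat_eq_append] at *
      refine ⟨K, x, rfl, fun w hw => ?_⟩
      have hwx := hne' x (by simp) w hw
      have hwz := hne' z hz w hw
      have hle := hmax w (by simp [hw])
      simp only [List.mem_append, List.mem_singleton] at hz
      rcases hz with hz | rfl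
      -- If `x < w`, then `z, x, m, w` is a forbidden pattern, since `w < z < m`.
      · have := h K x m L₂ (by simp) z hz w hw
        omega
      · omega
  · right
    cases L₂ with
    | nil => simp at hz
    | cons y K =>
      refine ⟨y, K, rfl, fun u hu => ?_⟩
      have hwx := hne' u hu y (by simp)
      have hwz := hne' u hu z hz
      have hle := hmax u (by simp [hu])
      simp only [List.mem_cons] at hz
      rcases hz with rfl | hz
      · omega
      · have := h L₁ m y K rfl u hu z hz
        omega

/-- The Baxter permutations of `0, …, n`, as lists. -/
def baxterLists : ℕ → Finset (List ℕ)
  | 0 => {[0]}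
  | n + 1 => (baxterLists n).biUnion fun L =>
      ((insertAfterMaxima (n + 1) L.reverse).map List.reverse).toFinset ∪
        (insertAfterMaxima (n + 1) L).toFinset

lemma perm_range_succ {n : ℕ} {L : List ℕ} :
    (n :: L).Perm (List.range (n + 1)) ↔ L.Perm (List.range n) := by
  rw [List.range_succ]
  constructor
  · intro h
    exact (h.trans (List.perm_append_singleton _ _)).cons_inv
  · intro h
    exact (h.cons _).trans (List.perm_append_singleton _ _).symm

lemma mem_baxterLists {n : ℕ} {L : List ℕ} :
    L ∈ baxterLists n ↔ L.Perm (List.range (n + 1)) ∧ IsBaxterList L := by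
  induction n generalizing L with
  | zero =>
    simp only [baxterLists, Finset.mem_singleton]
    constructor
    · rintro rfl
      refine ⟨by simp, ?_⟩
      intro L₁ x y L₂ h
      have := congrArg List.length h
      simp at this
      omega
    · rintro ⟨h, -⟩
      simpa using h
  | succ n ih =>
    simp only [baxterLists, Finset.mem_biUnion, ih, Finset.mem_union, List.mem_toFinset,
      List.mem_map]
    constructor
    · rintro ⟨K, ⟨hK, hB⟩, ⟨M, hM, rfl⟩ | hM⟩
      · have hlt : ∀ x ∈ K.reverse, x < n + 1 := fun x hx => by
          simpa using hK.subset (List.mem_reverse.1 hx)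
        refine ⟨(List.reverse_perm M).trans ((perm_of_mem_insertAfterMaxima hM).trans
          (perm_range_succ.2 ((List.reverse_perm K).trans hK))), ?_⟩
        obtain ⟨L₁, x, L₂, h, hx, rfl⟩ := mem_insertAfterMaxima.1 hM
        have hB' := hB.reverse
        rw [h] at hB' hlt
        exact (hB'.insert hlt hx).reverse
      · have hlt : ∀ x ∈ K, x < n + 1 := fun x hx => by simpa using hK.subset hx
        refine ⟨(perm_of_mem_insertAfterMaxima hM).trans (perm_range_succ.2 hK), ?_⟩
        obtain ⟨L₁, x, L₂, rfl, hx, rfl⟩ := mem_insertAfterMaxima.1 hM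
        exact hB.insert hlt hx
    · rintro ⟨hL, hB⟩
      have hmem : n + 1 ∈ L := hL.symm.subset (by simp)
      obtain ⟨L₁, L₂, rfl⟩ := List.append_of_mem hmem
      have hK : (L₁ ++ L₂).Perm (List.range (n + 1)) :=
        perm_range_succ.1 (List.perm_middle.symm.trans hL)
      have hlt : ∀ x ∈ L₁ ++ L₂, x < n + 1 := fun x hx => by simpa using hK.subset hx
      have hne : L₁ ++ L₂ ≠ [] := by
        intro h
        rw [h] at hK
        simpa using hK.length_eq
      refine ⟨L₁ ++ L₂, ⟨hK, hB.of_insert hlt⟩, ?_⟩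
      rcases hB.next_to_maximum hlt (hK.nodup_iff.2 List.nodup_range) hne with
        ⟨K, x, rfl, hx⟩ | ⟨y, K, rfl, hy⟩
      · right
        exact mem_insertAfterMaxima.2 ⟨K, x, L₂, by simp, hx, by simp⟩
      · left
        refine ⟨_, mem_insertAfterMaxima.2 ⟨K.reverse, y, L₁.reverse, by simp, by simpa using hy,
          rfl⟩, by simp⟩

/-- The sum of `φ` over Baxter permutations of `0, …, n`, as a function of the number of descents and
the numbers of left-to-right and right-to-left maxima (less one). -/
def baxterSum (n : ℕ) : (ℕ → ℕ → ℕ → ℤ) →+ ℤ :=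
  AddMonoidHom.mk' (fun φ => ∑ L ∈ baxterLists n,
      φ (descentCount L) (rlMaxima L.reverse - 1) (rlMaxima L - 1)) (by
    intro φ ψ
    simp only [Pi.add_apply, Finset.sum_add_distrib])

lemma baxterSum_apply (n : ℕ) (φ : ℕ → ℕ → ℕ → ℤ) :
    baxterSum n φ = ∑ L ∈ baxterLists n,
      φ (descentCount L) (rlMaxima L.reverse - 1) (rlMaxima L - 1) := rfl

lemma baxterSum_zero (φ : ℕ → ℕ → ℕ → ℤ) : baxterSum 0 φ = φ 0 0 0 := by
  simp [baxterSum_apply, baxterLists, descentCount, rlMaxima]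

lemma sum_map_insertAfterMaxima {m : ℕ} {L : List ℕ} (hL : ∀ x ∈ L, x < m) (hne : L ≠ [])
    (ψ : ℕ → ℤ) :
    ((insertAfterMaxima m L).map fun M => ψ (rlMaxima M - 1)).sum =
      ∑ x ∈ Finset.range (rlMaxima L - 1 + 1), ψ x := by
  have h : ((insertAfterMaxima m L).map fun M => ψ (rlMaxima M - 1)) =
      ((insertAfterMaxima m L).map rlMaxima).map fun i => ψ (i - 1) := by
    rw [List.map_map]
    rfl
  rw [h, map_rlMaxima_insertAfterMaxima hL, List.map_map,
    Nat.sub_add_cancel (Nat.succ_le_of_lt (rlMaxima_pos hne))]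
  rfl

/-- Insertion after a right-to-left maximum gives the labels `(d, i + 1, y)`. Reversal turns it into
insertion before a left-to-right maximum, which adds a descent and gives `(d + 1, x, j + 1)`. -/
lemma baxterSum_succ (n : ℕ) (φ : ℕ → ℕ → ℕ → ℤ) :
    baxterSum (n + 1) φ = baxterSum n (childSum φ) := by
  have hlt : ∀ L ∈ baxterLists n, ∀ x ∈ L, x < n + 1 := fun L hL x hx => by
    simpa using (mem_baxterLists.1 hL).1.subset hx
  have hlt' : ∀ L ∈ baxterLists n, ∀ x ∈ L.reverse, x < n + 1 := fun L hL x hx =>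
    hlt L hL x (List.mem_reverse.1 hx)
  have hnd : ∀ L ∈ baxterLists n, L.Nodup := fun L hL =>
    (mem_baxterLists.1 hL).1.nodup_iff.2 List.nodup_range
  have hne : ∀ L ∈ baxterLists n, L ≠ [] := by
    rintro L hL rfl
    simpa using (mem_baxterLists.1 hL).1.length_eq
  have hdes : ∀ L ∈ baxterLists n, ∀ M ∈ insertAfterMaxima (n + 1) L.reverse,
      descentCount M.reverse = descentCount L + 1 := by
    intro L hL M hM
    have hp := perm_of_mem_insertAfterMaxima hM
    have h1 := descentCount_of_mem_insertAfterMaxima (hlt' L hL) hM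
    have h2 := descentCount_reverse (hnd L hL) (hne L hL)
    have h3 := descentCount_reverse (L := M) (hp.nodup_iff.2 (List.nodup_cons.2
      ⟨fun h => (hlt' L hL _ h).false, List.nodup_reverse.2 (hnd L hL)⟩))
      (by rintro rfl; simpa using hp.length_eq)
    have h4 := hp.length_eq
    simp only [List.length_cons, List.length_reverse] at h4
    omega
  rw [baxterSum_apply, baxterSum_apply, baxterLists, Finset.sum_biUnion]
  · refine Finset.sum_congr rfl fun L hL => ?_
    rw [Finset.sum_union, childSum]
    · congr 1
      · rw [List.sum_toFinset _ ((nodup_insertAfterMaxima (hlt' L hL)).map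
          List.reverse_injective), List.map_map,
          ← sum_map_insertAfterMaxima (hlt' L hL) (by simpa using hne L hL)]
        congr 1
        refine List.map_congr_left fun M hM => ?_
        have hpos := rlMaxima_pos (hne L hL)
        have h := rlMaxima_reverse_of_mem_insertAfterMaxima (hlt' L hL) hM
        rw [List.reverse_reverse] at h
        rw [Function.comp_apply, hdes L hL M hM, List.reverse_reverse, h]
        congr 1
        omega
      · rw [List.sum_toFinset _ (nodup_insertAfterMaxima (hlt L hL)),
          ← sum_map_insertAfterMaxima (hlt L hL) (hne L hL)]
        congr 1
        refine List.map_congr_left fun M hM => ?_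
        have hpos := rlMaxima_pos (L := L.reverse) (by simpa using hne L hL)
        rw [descentCount_of_mem_insertAfterMaxima (hlt L hL) hM,
          rlMaxima_reverse_of_mem_insertAfterMaxima (hlt L hL) hM]
        congr 1
        omega
    -- The two kinds of children differ in their number of descents.
    · rw [Finset.disjoint_left]
      intro M hM hM'
      simp only [List.mem_toFinset, List.mem_map] at hM hM'
      obtain ⟨M, hM, rfl⟩ := hM
      have h1 := hdes L hL M hM
      have h2 := descentCount_of_mem_insertAfterMaxima (hlt L hL) hM'
      omega
  -- Deleting the maximum recovers the parent, so distinct parents have disjoint sets of children.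
  · have key : ∀ L ∈ baxterLists n, ∀ M,
        M ∈ ((insertAfterMaxima (n + 1) L.reverse).map List.reverse).toFinset ∪
          (insertAfterMaxima (n + 1) L).toFinset → M.filter (· < n + 1) = L := by
      intro L hL M hM
      simp only [Finset.mem_union, List.mem_toFinset, List.mem_map] at hM
      rcases hM with ⟨M, hM, rfl⟩ | hM
      · rw [List.filter_reverse, filter_of_mem_insertAfterMaxima (hlt' L hL) hM,
          List.reverse_reverse]
      · exact filter_of_mem_insertAfterMaxima (hlt L hL) hM
    intro L hL K hK hLK
    rw [Function.onFun, Finset.disjoint_left]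
    intro M hM hM'
    exact hLK ((key L hL M hM).symm.trans (key K hK M hM'))

lemma card_baxterLists_descentCount (k l : ℕ) :
    (((baxterLists (k + l)).filter fun L => descentCount L = k).card : ℚ) = theta k l := by
  have h := binomialWeight_sum_eq_quadrantWalks baxterSum baxterSum_zero baxterSum_succ (k + l) k 0 0
  rw [← quadrantWalks_eq_theta, ← h, ← Int.cast_natCast]
  congr 1
  simp only [baxterSum_apply, binomialWeight_zero_zero, Finset.sum_boole]

/-! ### From permutations to lists -/

/-- The values of a permutation, in order. -/
def permList {n : ℕ} (π : Equiv.Perm (Fin n)) : List ℕ := List.ofFn fun i => (π i : ℕ)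

lemma permList_injective (n : ℕ) : Function.Injective (permList (n := n)) := by
  intro π σ h
  ext i
  exact congrFun (List.ofFn_injective h) i

lemma permList_perm_range {n : ℕ} (π : Equiv.Perm (Fin n)) :
    (permList π).Perm (List.range n) := by
  rw [List.perm_ext_iff_of_nodup _ List.nodup_range]
  · intro a
    simp only [permList, List.mem_ofFn, List.mem_range]
    constructor
    · rintro ⟨i, rfl⟩
      exact (π i).isLt
    · intro h
      exact ⟨π.symm ⟨a, h⟩, by simp⟩
  · exact List.nodup_ofFn.2 (Fin.val_injective.comp π.injective)

lemma exists_permList_eq {n : ℕ} {L : List ℕ} (h : L.Perm (List.range n)) :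
    ∃ π : Equiv.Perm (Fin n), permList π = L := by
  have hlen : L.length = n := by simpa using h.length_eq
  subst hlen
  have hlt (i : Fin L.length) : L[i] < L.length :=
    List.mem_range.1 (h.subset (List.getElem_mem i.isLt))
  have hinj : Function.Injective fun i : Fin L.length => (⟨L[i], hlt i⟩ : Fin L.length) := by
    intro i j hij
    have h' : L[i] = L[j] := congrArg Fin.val hij
    exact Fin.ext ((h.nodup_iff.2 List.nodup_range).getElem_inj_iff.1 h')
  refine ⟨Equiv.ofBijective _ (Finite.injective_iff_bijective.1 hinj), ?_⟩
  simp [permList]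

lemma getElem?_permList {n : ℕ} {π : Equiv.Perm (Fin n)} {j x : ℕ} :
    (permList π)[j]? = some x ↔ ∃ h : j < n, (π ⟨j, h⟩ : ℕ) = x := by
  simp [permList, List.getElem?_ofFn]

lemma isBaxterList_permList {n : ℕ} {π : Equiv.Perm (Fin n)} :
    IsBaxterList (permList π) ↔ IsBaxter π := by
  constructor
  · intro h i j j' k hij hj hjk
    have hlen : (permList π).length = n := by simp [permList]
    have hdec : permList π = (permList π).take j ++ (π j : ℕ) :: (π j' : ℕ) ::
        (permList π).drop (j' + 1) := by
      conv_lhs => rw [← List.take_append_drop j (permList π)]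
      rw [List.drop_eq_getElem_cons (by omega), List.drop_eq_getElem_cons (by omega)]
      simp [permList, ← hj]
    have := h _ _ _ _ hdec (π i) (by
        rw [List.mem_iff_getElem?]
        refine ⟨i, ?_⟩
        rw [List.getElem?_take, if_pos (Fin.lt_def.1 hij)]
        exact getElem?_permList.2 ⟨i.isLt, rfl⟩)
      (π k) (by
        rw [List.mem_iff_getElem?]
        refine ⟨k - (j' + 1), ?_⟩
        rw [List.getElem?_drop, getElem?_permList]
        have : (j' : ℕ) + 1 + (k - (j' + 1)) = k := by
          have : (j' : ℕ) < k := hjk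
          omega
        exact ⟨by omega, by simp only [this]⟩)
    simp only [gt_iff_lt, Fin.lt_def] at this ⊢
    tauto
  · intro h L₁ x y L₂ hL u hu w hw
    obtain ⟨i, hi⟩ := List.mem_iff_getElem?.1 hu
    obtain ⟨m, hm⟩ := List.mem_iff_getElem?.1 hw
    have hi' : i < L₁.length := (List.getElem?_eq_some_iff.1 hi).1
    obtain ⟨h1, rfl⟩ := getElem?_permList.1 (show (permList π)[i]? = some u by
      rw [hL, List.getElem?_append_left hi', hi])
    obtain ⟨h2, rfl⟩ := getElem?_permList.1 (show (permList π)[L₁.length]? = some x by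
      rw [hL, List.getElem?_append_right le_rfl]; simp)
    obtain ⟨h3, rfl⟩ := getElem?_permList.1 (show (permList π)[L₁.length + 1]? = some y by
      rw [hL, List.getElem?_append_right (by omega)]; simp)
    obtain ⟨h4, rfl⟩ := getElem?_permList.1 (show (permList π)[L₁.length + 2 + m]? = some w by
      rw [hL, List.getElem?_append_right (by omega),
        show L₁.length + 2 + m - L₁.length = m + 1 + 1 by omega]
      simpa using hm)
    have := h ⟨i, h1⟩ ⟨_, h2⟩ ⟨_, h3⟩ ⟨_, h4⟩ (by simpa using hi') rfl (by simp [Fin.lt_def]; omega)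
    simp only [gt_iff_lt, Fin.lt_def] at this ⊢
    tauto

/-! ### Descents, rises and the final counts -/

open Classical in
lemma descentCount_ofFn (n : ℕ) (f : Fin n → ℕ) :
    descentCount (List.ofFn f) =
      ∑ i : Fin n, if ∃ h : (i : ℕ) + 1 < n, f ⟨(i : ℕ) + 1, h⟩ < f i then 1 else 0 := by
  induction n with
  | zero => simp [descentCount]
  | succ n ih =>
    cases n with
    | zero =>
      rw [Fin.sum_univ_one, if_neg (by rintro ⟨h, -⟩; simp at h)]
      rfl
    | succ n =>
      have ih := ih fun i => f i.succ
      rw [List.ofFn_succ] at ih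
      rw [List.ofFn_succ, List.ofFn_succ, descentCount, ih, Fin.sum_univ_succ (n := n + 1)]
      congr 1
      · simp
        rfl
      · refine Finset.sum_congr rfl fun i _ => ?_
        simp only [Fin.val_succ, Nat.add_lt_add_iff_right]
        rfl

lemma descents_eq_descentCount {n : ℕ} (π : Equiv.Perm (Fin n)) :
    descents π = descentCount (permList π) := by
  classical
  rw [permList, descentCount_ofFn, descents, Set.ncard_eq_toFinset_card']
  simp [Finset.sum_boole]

lemma descents_add_rises {n : ℕ} (π : Equiv.Perm (Fin (n + 1))) :
    descents π + rises π = n := by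
  rw [descents, rises, ← Set.ncard_union_eq]
  · have h : {i : Fin (n + 1) | ∃ h : (i : ℕ) + 1 < n + 1, π i > π ⟨(i : ℕ) + 1, h⟩} ∪
        {i : Fin (n + 1) | ∃ h : (i : ℕ) + 1 < n + 1, π i < π ⟨(i : ℕ) + 1, h⟩} =
        Set.range (Fin.castSucc : Fin n → Fin (n + 1)) := by
      ext i
      simp only [Set.mem_union, Set.mem_ofPred_eq, Set.mem_range]
      constructor
      · rintro (⟨h, -⟩ | ⟨h, -⟩) <;> exact ⟨⟨i, by omega⟩, rfl⟩
      · rintro ⟨j, rfl⟩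
        have hj : (j : ℕ) + 1 < n + 1 := by omega
        have hne : π j.castSucc ≠ π ⟨(j : ℕ) + 1, hj⟩ := by
          intro h
          have := congrArg Fin.val (π.injective h)
          simp at this
        rcases lt_or_gt_of_ne hne with h | h
        · exact Or.inr ⟨hj, h⟩
        · exact Or.inl ⟨hj, h⟩
    rw [h, ← Set.image_univ, Set.ncard_image_of_injective _ (Fin.castSucc_injective n)]
    simp
  · rw [Set.disjoint_left]
    rintro i ⟨_, h⟩ ⟨_, h'⟩
    exact lt_asymm h h'

/-- The predicate is `(· = k)` for the refined count and constantly true for the total; rises need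
no separate treatment, as they are determined by the descents. -/
lemma ncard_isBaxter_and (n : ℕ) (p : ℕ → Prop) [DecidablePred p] :
    Set.ncard {π : Equiv.Perm (Fin (n + 1)) | IsBaxter π ∧ p (descents π)} =
      ((baxterLists n).filter fun L => p (descentCount L)).card := by
  rw [← Set.ncard_image_of_injective _ (permList_injective (n + 1)), ← Set.ncard_coe_finset]
  congr 1
  ext L
  simp only [Set.mem_image, Set.mem_ofPred_eq, Finset.coe_filter, mem_baxterLists]
  constructor
  · rintro ⟨π, ⟨hB, hp⟩, rfl⟩
    exact ⟨⟨permList_perm_range π, isBaxterList_permList.2 hB⟩, descents_eq_descentCount π ▸ hp⟩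
  · rintro ⟨⟨hL, hB⟩, hp⟩
    obtain ⟨π, rfl⟩ := exists_permList_eq hL
    exact ⟨π, ⟨isBaxterList_permList.1 hB, (descents_eq_descentCount π).symm ▸ hp⟩, rfl⟩

theorem ncard_isBaxter_descents_rises (k l : ℕ) :
    (Set.ncard {π : Equiv.Perm (Fin (k + l + 1)) |
      IsBaxter π ∧ descents π = k ∧ rises π = l} : ℚ) = theta k l := by
  rw [← card_baxterLists_descentCount, ← ncard_isBaxter_and (k + l) (· = k)]
  congr 2
  ext π
  have := descents_add_rises π
  simp only [Set.mem_ofPred_eq]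
  refine and_congr_right fun _ => ⟨fun h => h.1, fun h => ⟨h, by omega⟩⟩

theorem ncard_isBaxter (n : ℕ) :
    (Set.ncard {π : Equiv.Perm (Fin (n + 1)) | IsBaxter π} : ℚ) = baxterNumber (n + 1) := by
  have hcard : Set.ncard {π : Equiv.Perm (Fin (n + 1)) | IsBaxter π} = (baxterLists n).card := by
    simpa using ncard_isBaxter_and n fun _ => True
  have hlt : ∀ L ∈ baxterLists n, descentCount L ∈ Finset.range (n + 1) := by
    intro L hL
    obtain ⟨π, rfl⟩ := exists_permList_eq (mem_baxterLists.1 hL).1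
    have := descents_add_rises π
    rw [descents_eq_descentCount] at this
    rw [Finset.mem_range]
    omega
  rw [hcard, Finset.card_eq_sum_card_fiberwise hlt, baxterNumber, Nat.cast_sum]
  refine Finset.sum_congr rfl fun k hk => ?_
  rw [Finset.mem_range] at hk
  obtain ⟨l, rfl⟩ := Nat.exists_eq_add_of_le (Nat.lt_succ_iff.1 hk)
  rw [card_baxterLists_descentCount]
  congr 1
  omega

end Baxter

theorem mainTheorem3 :
    (∀ k l : ℕ, (Baxter.twinPairs (k + 1) (l + 1)).Finite ∧
      ((Baxter.twinPairs (k + 1) (l + 1)).ncard : ℚ) = Baxter.theta k l) ∧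
    (∀ k l : ℕ,
      (Set.ncard {π : Equiv.Perm (Fin (k + l + 1)) |
        Baxter.IsBaxter π ∧ Baxter.descents π = k ∧ Baxter.rises π = l} : ℚ) =
          Baxter.theta k l) ∧
    (∀ n : ℕ, 1 ≤ n →
      (Set.ncard {π : Equiv.Perm (Fin n) | Baxter.IsBaxter π} : ℚ) =
        Baxter.baxterNumber n) := by
  refine ⟨fun k l => ⟨Baxter.finite_twinPairs k l, Baxter.ncard_twinPairs k l⟩,
    Baxter.ncard_isBaxter_descents_rises, fun n hn => ?_⟩
  obtain ⟨n, rfl⟩ := Nat.exists_eq_add_of_le' hn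
  exact Baxter.ncard_isBaxter n
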